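/- **Stokes circles.** An exponential factor is a finite sum $q=\sum_{k} a_k z^{k}$ over rational exponents $k>0$, $a_k\in\mathbb C$. The Galois conjugates of $q$ are the sums $\sum_k a_k e^{2\pi i mk}z^k$, $m\in\mathbb Z$; the Galois orbit $I=\langle q\rangle$ is called a Stokes circle. Its set of exponents is $E(I)=\{k: a_k\neq 0\}$, and its ramification order $\mathrm{Ram}(I)$ is the least integer $r\ge1$ with $E(I)\subset\frac1r\mathbb Z$. The slope of $q$ is its largest exponent ($0$ if $q=0$). An irregular class is a finite multiset $\Theta=\sum_{i\in N} n_iI_i$ of Stokes circles ($n_i\geq 1$, $I_i$ pairwise distinct); it is untwisted if all $\mathrm{Ram}(I_i)=1$. Let $(E,\nabla)$ be an algebraic connection on the affine line $\mathbb A^1(\mathbb C)$ with coordinate $z$, written in a basis as $\nabla_{d/dz}=\frac{d}{dz}+A(z)$. Its irregular class $\Theta$ at infinity is the one given by the Turrittin–Levelt theorem: the system $Y'=-AY$ has a formal fundamental solution $P(t)\,t^{\Lambda}e^{\mathrm{diag}(q_1,\dots,q_n)}$ at $\infty$, where $z=t^{-R}$ for some integer $R\ge 1$, $P$ is an invertible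 matrix of formal Laurent series in $t$, the $q_a$ are exponential factors that are polynomials in $z^{1/R}$, and $\Lambda$ is a constant matrix commuting with $\mathrm{diag}(q_1,\dots,q_n)$; every exponential factor $q$ occurs among $q_1,\dots,q_n$ exactly as many times as $\langle q\rangle$ occurs in $\Theta$. **Multiplicities.** For a Stokes circle $I$ with $r=\mathrm{Ram}(I)$ and $E(I)=\{k_0>\dots>k_p\}$, $k_j=m_j/r$, put $$B_{I,I}=\sum_{j=0}^{p} m_j\bigl(\gcd(r,m_0,\dots,m_{j-1})-\gcd(r,m_0,\dots,m_j)\bigr)-r^2+1 .$$ Let $I=\langle q\rangle\ne J=\langle q'\rangle$ with ramification orders $r,r'$. Let $\tau_l(q)$ be the sum of the monomials of $q$ of exponent $\ge l$, let $k$ be the least $l\in\frac{1}{\mathrm{lcm}(r,r')}\mathbb Z_{>0}$ with $\langle\tau_l(q)\rangle=\langle\tau_l(q')\rangle$, and let $q_d=q-\tau_k(q)$, $q'_d=q'-\tau_k(q')$. Let $k_0>\dots>k_t$ be the exponents (if any) of $\langle\tau_k(q)\rangle$, $k_j=m_j/r=m'_j/r'$. If $\mathrm{Slope}(q_d)\ge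 \mathrm{Slope}(q'_d)$ and $\mathrm{Slope}(q_d)=s_d/r$, put $$B_{I,J}=B_{J,I}=\sum_{j=0}^{t} m_j\bigl(\gcd(r',m'_0,\dots,m'_{j-1})-\gcd(r',m'_0,\dots,m'_j)\bigr)+s_d\gcd(r',m'_0,\dots,m'_t)-rr'.$$ (In both formulas the first $\gcd$ in the term $j=0$ is $r$, respectively $r'$; if there are no exponents $k_j$, the sum is $0$ and the last $\gcd$ of the second formula is $r'$.) **Diagrams.** A diagram is a pair $(N,B)$ with $N$ a finite nonempty set and $B=(B_{ij})_{i,j\in N}$ a symmetric integer matrix with even diagonal entries ($B_{ij}$ is the number of edges between $i\ne j$, $B_{ii}/2$ the number of loops at $i$). It is a graph if $B_{ii}=0$ and $B_{ij}\ge 0$ for all $i,j$, and it is simply-laced if it is a graph with $B_{ij}\in\{0,1\}$ for all $i\neq j$. The core diagram $\Gamma_c(\Theta)$ of $\Theta=\sum_{i\in N} n_iI_i$ is $(N,(B_{I_i,I_j})_{i,j\in N})$. A diagram is a nonabelian Hodge diagram if (up to relabelling its vertices) it is $\Gamma_c(\Theta)$ for the irregular class $\Theta$ at infinity of an algebraic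 connection on the affine line, and a fission graph if it is so for a connection with untwisted $\Theta$. It is a complete $k$-partite graph if $N$ can be partitioned into $k$ nonempty parts such that $B_{ij}=0$ for $i,j$ in the same part (including $i=j$) and $B_{ij}=1$ for $i,j$ in different parts. **Proposition 4.5 (also Theorem 1.5).** Every simply-laced nonabelian Hodge diagram is a simply-laced fission graph, and is a complete $k$-partite graph for some integer $k\ge1$. Moreover, the simply-laced fission graphs are exactly the diagrams that are complete $k$-partite graphs for some integer $k\geq 1$. -/

import Mathlib

open scoped Polynomial LaurentSeries

noncomputable section

/-! ### Diagrams and graphs -/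

/-- A diagram on a (finite) vertex set `N`: a symmetric integer matrix with even diagonal.
`B i j` is the number of edges between distinct `i`, `j`, and `B i i / 2` the number of loops. -/
structure Diagram (N : Type*) where
  B : Matrix N N ℤ
  symm : ∀ i j, B i j = B j i
  even_diag : ∀ i, Even (B i i)

namespace Diagram

variable {N : Type*}

/-- A graph is a diagram without loops nor negative edges. -/
def IsGraph (Γ : Diagram N) : Prop :=
  (∀ i j, 0 ≤ Γ.B i j) ∧ ∀ i, Γ.B i i = 0

/-- A simply-laced diagram is a graph (in particular it has no loops)
whose edge multiplicities are all `0` or `1`. -/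
def IsSimplyLaced (Γ : Diagram N) : Prop :=
  Γ.IsGraph ∧ ∀ i j, i ≠ j → Γ.B i j = 0 ∨ Γ.B i j = 1

/-- Complete `k`-partite graphs: the vertices are partitioned into `k` nonempty parts, there is
no edge inside a part, and exactly one edge between any two vertices in different parts. -/
def IsCompletePartite (Γ : Diagram N) (k : ℕ) : Prop :=
  ∃ f : N → Fin k, Function.Surjective f ∧
    (∀ i j, f i = f j → Γ.B i j = 0) ∧ (∀ i j, f i ≠ f j → Γ.B i j = 1)

end Diagram

/-! ### Exponential factors and Stokes circles at infinity -/

/-- An exponential factor `q = ∑ a_k z ^ k`: a finite sum over positive rational exponents `k`,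
i.e. a polynomial without constant term in some root `z ^ (1 / r)`. -/
@[ext]
structure ExpFactor where
  coeff : ℚ →₀ ℂ
  pos : ∀ k ∈ coeff.support, 0 < k

namespace ExpFactor

/-- The set of exponents of `q`. -/
def exponents (q : ExpFactor) : Finset ℚ := q.coeff.support

/-- The ramification order: the least `r ≥ 1` such that all exponents of `q` lie in `(1 / r) ℤ`
(see `isLeast_ram`). -/
def ram (q : ExpFactor) : ℕ := q.exponents.lcm Rat.den

theorem isLeast_ram (q : ExpFactor) :
    IsLeast {r : ℕ | 1 ≤ r ∧ ∀ k ∈ q.exponents, ∃ j : ℕ, k = (j : ℚ) / r} q.ram := by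
  have hne : q.ram ≠ 0 := by
    intro h
    rw [ram, Finset.lcm_eq_zero_iff] at h
    obtain ⟨k, -, hk⟩ := h
    exact k.den_ne_zero hk
  refine ⟨⟨Nat.one_le_iff_ne_zero.mpr hne, fun k hk => ?_⟩, ?_⟩
  · obtain ⟨c, hc⟩ : k.den ∣ q.ram := Finset.dvd_lcm hk
    have hc0 : c ≠ 0 := by
      rintro rfl
      exact hne (by simpa using hc)
    have hk0 : 0 < k := q.pos k hk
    refine ⟨k.num.natAbs * c, ?_⟩
    have h1 : (((k.num.natAbs : ℕ) : ℤ) : ℚ) = k.num := by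
      have h2 : ((k.num.natAbs : ℕ) : ℤ) = k.num :=
        Int.natAbs_of_nonneg (Rat.num_pos.mpr hk0).le
      exact congrArg (Int.cast : ℤ → ℚ) h2
    have hd : (k.den : ℚ) ≠ 0 := by exact_mod_cast k.den_ne_zero
    have hc' : (c : ℚ) ≠ 0 := by exact_mod_cast hc0
    rw [hc]
    rw [Nat.cast_mul, Nat.cast_mul, ← Int.cast_natCast k.num.natAbs, h1, mul_div_mul_right _ _ hc', Rat.num_div_den]
  · rintro r ⟨hr, h⟩
    refine Nat.le_of_dvd hr (Finset.lcm_dvd fun k hk => ?_)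
    obtain ⟨j, rfl⟩ := h k hk
    have h2 := Rat.den_dvd (j : ℤ) (r : ℤ)
    have h3 : (Rat.divInt (j : ℤ) (r : ℤ)) = (j : ℚ) / r := by
      rw [Rat.divInt_eq_div]; simp
    rw [h3] at h2
    exact_mod_cast h2

/-- Galois conjugation: `q` and `q'` are conjugate if `q'` is obtained from `q` by turning `m` times
around infinity for some integer `m`, i.e. by replacing `z ^ k` with `exp (2 π i m k) z ^ k`. -/
instance setoid : Setoid ExpFactor where
  r q q' := ∃ m : ℤ, ∀ k : ℚ,
    q'.coeff k = Complex.exp (2 * Real.pi * Complex.I * m * k) * q.coeff k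
  iseqv :=
    { refl := fun q => ⟨0, fun k => by simp⟩
      symm := by
        rintro q q' ⟨m, h⟩
        refine ⟨-m, fun k => ?_⟩
        rw [h k, ← mul_assoc, ← Complex.exp_add]
        have : 2 * Real.pi * Complex.I * ((-m : ℤ) : ℂ) * k
            + 2 * Real.pi * Complex.I * (m : ℂ) * k = 0 := by
          push_cast; ring
        rw [this, Complex.exp_zero, one_mul]
      trans := by
        rintro q q' q'' ⟨m, h⟩ ⟨m', h'⟩
        refine ⟨m' + m, fun k => ?_⟩
        rw [h' k, h k, ← mul_assoc, ← Complex.exp_add]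
        congr 2
        push_cast
        ring }

theorem exponents_eq_of_equiv {q q' : ExpFactor} (h : q ≈ q') : q.exponents = q'.exponents := by
  obtain ⟨m, h⟩ := h
  ext k
  simp [exponents, h k]

/-- The truncation `τ_l (q)`: all monomials of exponent `< l` are removed. -/
def trunc (l : ℚ) (q : ExpFactor) : ExpFactor where
  coeff := q.coeff.filter (fun k => l ≤ k)
  pos k hk := q.pos k (by
    rw [Finsupp.support_filter] at hk
    exact (Finset.mem_filter.mp hk).1)

theorem trunc_equiv (l : ℚ) {q q' : ExpFactor} (h : q ≈ q') : q.trunc l ≈ q'.trunc l := by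
  obtain ⟨m, h⟩ := h
  refine ⟨m, fun k => ?_⟩
  by_cases hk : l ≤ k <;> simp [trunc, hk, h k]

/-- The pullback of `q` to the cover `z = t ^ (-R)` (where `ram q ∣ R`), as a Laurent series in `t`:
the monomial `z ^ k` becomes `t ^ (- R k)`. -/
def toLaurent (R : ℕ) (q : ExpFactor) : ℂ⸨X⸩ :=
  ∑ k ∈ q.exponents, HahnSeries.single (-((R : ℚ) * k).num) (q.coeff k)

end ExpFactor

/-- A Stokes circle (at infinity): the Galois orbit of an exponential factor. -/
def StokesCircle : Type := Quotient ExpFactor.setoid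

/-- The Stokes circle `⟨q⟩` of an exponential factor `q`. -/
def ExpFactor.circle (q : ExpFactor) : StokesCircle := Quotient.mk ExpFactor.setoid q

namespace StokesCircle

/-- The set of exponents `E(I)` of a Stokes circle. -/
def exponents (I : StokesCircle) : Finset ℚ :=
  Quotient.lift ExpFactor.exponents (fun _ _ h => ExpFactor.exponents_eq_of_equiv h) I

/-- The ramification order of a Stokes circle. -/
def ram (I : StokesCircle) : ℕ :=
  Quotient.lift ExpFactor.ram
    (fun _ _ h => by simp only [ExpFactor.ram, ExpFactor.exponents_eq_of_equiv h]) I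

/-- The truncation `⟨τ_l (q)⟩` of a Stokes circle `⟨q⟩`. -/
def trunc (l : ℚ) (I : StokesCircle) : StokesCircle :=
  Quotient.map (ExpFactor.trunc l) (fun _ _ h => ExpFactor.trunc_equiv l h) I

/-- For `k ∈ E(I)` and any multiple `r` of the denominator of `k`, the integer `m = r k`,
so that `k = m / r`. -/
def numer (r : ℕ) (k : ℚ) : ℕ := ((r : ℚ) * k).num.natAbs

/-- `gcd (r, m_k : k ∈ S)`, where `k = m_k / r`; it is `r` when `S` is empty. -/
def gcdOf (r : ℕ) (S : Finset ℚ) : ℕ := Nat.gcd r (S.gcd (numer r))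

/-- The loop multiplicity
`B_{I,I} = ∑_j m_j (gcd (r, m_0, …, m_{j-1}) - gcd (r, m_0, …, m_j)) - r ^ 2 + 1`,
the sum being over all exponents `k_0 > ⋯ > k_p` of `I`, `k_j = m_j / r`. -/
def loopMult (I : StokesCircle) : ℤ :=
  ∑ k ∈ I.exponents, (numer I.ram k : ℤ) *
      ((gcdOf I.ram (I.exponents.filter (fun l => k < l)) : ℤ)
        - (gcdOf I.ram (I.exponents.filter (fun l => k ≤ l)) : ℤ))
    - (I.ram : ℤ) ^ 2 + 1

/-- For distinct circles `⟨q⟩`, `⟨q'⟩`, the smallest `l` in `(1 / lcm (r, r')) ℤ_{>0}` such that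
`⟨τ_l (q)⟩ = ⟨τ_l (q')⟩`. -/
def commonThreshold (I J : StokesCircle) : ℚ :=
  (sInf {n : ℕ | 0 < n ∧
      I.trunc ((n : ℚ) / (Nat.lcm I.ram J.ram : ℕ)) = J.trunc ((n : ℚ) / (Nat.lcm I.ram J.ram : ℕ))} : ℕ)
    / (Nat.lcm I.ram J.ram : ℕ)

/-- The common part `⟨q_c⟩ = ⟨q'_c⟩` of two circles. -/
def commonPart (I J : StokesCircle) : StokesCircle := I.trunc (commonThreshold I J)

/-- The slope of the different part `q_d = q - q_c` of `q` with respect to `q'`, where `I = ⟨q⟩`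
and `J = ⟨q'⟩`: its largest exponent (and `0` if `q_d = 0`). -/
def diffSlope (I J : StokesCircle) : ℚ :=
  (insert 0 (I.exponents.filter (fun k => k < commonThreshold I J))).max'
    (Finset.insert_nonempty _ _)

/-- The expression for the edge multiplicity when `Slope (q_d) ≥ Slope (q'_d)`:
`∑_j m_j (gcd (r', m'_0, …, m'_{j-1}) - gcd (r', m'_0, …, m'_j)) + s_d gcd (r', m'_0, …, m'_t) - r r'`
where `k_0 > ⋯ > k_t` are the exponents of the common part, `k_j = m_j / r = m'_j / r'`, and
`Slope (q_d) = s_d / r`. -/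
def edgeFormula (I J : StokesCircle) : ℤ :=
  ∑ k ∈ (commonPart I J).exponents, (numer I.ram k : ℤ) *
      ((gcdOf J.ram ((commonPart I J).exponents.filter (fun l => k < l)) : ℤ)
        - (gcdOf J.ram ((commonPart I J).exponents.filter (fun l => k ≤ l)) : ℤ))
    + (numer I.ram (diffSlope I J) : ℤ) * (gcdOf J.ram (commonPart I J).exponents : ℤ)
    - (I.ram : ℤ) * (J.ram : ℤ)

/-- The edge multiplicity `B_{I,J}` of two distinct Stokes circles. -/
def edgeMult (I J : StokesCircle) : ℤ :=
  if diffSlope J I ≤ diffSlope I J then edgeFormula I J else edgeFormula J I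

end StokesCircle

/-! ### Irregular classes and their core diagrams -/

/-- An irregular class at infinity: a finite multiset `∑ n_I I` of Stokes circles. -/
abbrev IrregularClass : Type := StokesCircle →₀ ℕ

/-- Untwisted irregular classes: all Stokes circles have ramification order `1`. -/
def IrregularClass.IsUntwisted (Θ : IrregularClass) : Prop := ∀ I ∈ Θ.support, I.ram = 1

/-- `Γ` is (up to a labelling of its vertices) the core diagram `Γ_c(Θ)`: its vertices are the
distinct Stokes circles of `Θ`, and its multiplicities are those of the circles. -/
def Diagram.IsCoreDiagramOf {N : Type*} (Γ : Diagram N) (Θ : IrregularClass) : Prop :=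
  ∃ e : N ≃ {I : StokesCircle // I ∈ Θ.support},
    (∀ i, Γ.B i i = StokesCircle.loopMult (e i).1) ∧
    (∀ i j, i ≠ j → Γ.B i j = StokesCircle.edgeMult (e i).1 (e j).1)

/-! ### Algebraic connections on the affine line -/

/-- An algebraic connection on the affine line: a vector bundle, i.e. a finitely generated
projective `ℂ[z]`-module `E`, with an additive operator `∇ = ∇_{d/dz}` satisfying the Leibniz rule
(which implies `ℂ`-linearity). -/
structure AlgConnection where
  E : Type
  [addCommGroup : AddCommGroup E]
  [module : Module ℂ[X] E]
  [finite : Module.Finite ℂ[X] E]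
  [projective : Module.Projective ℂ[X] E]
  nabla : E →+ E
  leibniz : ∀ (f : ℂ[X]) (s : E), nabla (f • s) = Polynomial.derivative f • s + f • nabla s

attribute [instance] AlgConnection.addCommGroup AlgConnection.module AlgConnection.finite
  AlgConnection.projective

namespace AlgConnection

/-- The connection matrix `A` in a basis `b`: `∇ b_j = ∑ i, A i j • b_i`, so that `∇ = d/dz + A`
in this basis, and horizontal sections are the solutions of `dY/dz = - A Y`. -/
def connMatrix (V : AlgConnection) {n : ℕ} (b : Module.Basis (Fin n) ℂ[X] V.E) :
    Matrix (Fin n) (Fin n) ℂ[X] :=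
  fun i j => b.repr (V.nabla (b j)) i

end AlgConnection

/-- The Euler derivation `t d/dt` on Laurent series in `t`. -/
def eulerD (f : ℂ⸨X⸩) : ℂ⸨X⸩ := HahnSeries.single (1 : ℤ) (1 : ℂ) * LaurentSeries.derivative ℂ f

/-- The system `dY/dz = - A Y` has, near infinity, the formal fundamental solution
`Y = P(t) t ^ Λ exp (diag (q_1, …, q_n))` with `z = t ^ (-R)`, where `P` is an invertible matrix of
formal Laurent series in `t`, `q_1, …, q_n` are exponential factors in `z ^ (1 / R)`, and `Λ` is a
constant matrix commuting with `diag (q_1, …, q_n)`.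
Since `t d/dt = - R z d/dz`, the equation reads
`t dP/dt + P (Λ + diag (t dq_a/dt)) = R z A(z) P` with `z = t ^ (-R)`. -/
structure IsFormalSolution {n : ℕ} (A : Matrix (Fin n) (Fin n) ℂ[X]) (R : ℕ)
    (P : Matrix (Fin n) (Fin n) ℂ⸨X⸩) (Λ : Matrix (Fin n) (Fin n) ℂ)
    (q : Fin n → ExpFactor) : Prop where
  pos : 0 < R
  ram_dvd : ∀ a, (q a).ram ∣ R
  isUnit : IsUnit P
  commute : ∀ a c, q a ≠ q c → Λ a c = 0
  eqn : P.map eulerD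
      + P * (Λ.map HahnSeries.C + Matrix.diagonal (fun a => eulerD ((q a).toLaurent R)))
    = (HahnSeries.single (-(R : ℤ)) (R : ℂ)) •
        (A.map (Polynomial.aeval (HahnSeries.single (-(R : ℤ)) (1 : ℂ) : ℂ⸨X⸩)) * P)

/-- `Θ` is the irregular class at infinity of the connection `V`: for a formal fundamental solution
at infinity as in the Turrittin–Levelt theorem, each exponential factor `q` occurs
with the multiplicity `Θ ⟨q⟩` of its Stokes circle in `Θ`. -/
def AlgConnection.HasIrregularClass (V : AlgConnection) (Θ : IrregularClass) : Prop :=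
  ∃ (n : ℕ) (b : Module.Basis (Fin n) ℂ[X] V.E) (R : ℕ) (P : Matrix (Fin n) (Fin n) ℂ⸨X⸩)
    (Λ : Matrix (Fin n) (Fin n) ℂ) (q : Fin n → ExpFactor),
    IsFormalSolution (V.connMatrix b) R P Λ q ∧
    ∀ p : ExpFactor, Nat.card {a : Fin n // q a = p} = Θ p.circle

/-! ### Nonabelian Hodge diagrams and fission graphs -/

namespace Diagram

variable {N : Type*}

/-- A nonabelian Hodge diagram is the core diagram of an algebraic connection on the
affine line. -/
def IsNonabelianHodge (Γ : Diagram N) : Prop :=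
  ∃ (V : AlgConnection) (Θ : IrregularClass), V.HasIrregularClass Θ ∧ Γ.IsCoreDiagramOf Θ

/-- A fission graph is the core diagram of an algebraic connection on the affine line with
untwisted irregular class at infinity. -/
def IsFissionGraph (Γ : Diagram N) : Prop :=
  ∃ (V : AlgConnection) (Θ : IrregularClass),
    V.HasIrregularClass Θ ∧ Θ.IsUntwisted ∧ Γ.IsCoreDiagramOf Θ

end Diagram

end

/-! For distinct circles `I`, `J` let `δ` be the largest exponent at which they differ
(`IsDistance`). The gcds in the edge formula count conjugates: `gcd(r', m'_0, …, m'_j) / r'` is the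
reciprocal of the least common denominator of `k_0, …, k_j`, hence the proportion of the Galois
orbit that agrees with a given factor at these exponents. The formula thus becomes `B_{I,J} = r r'
(M_J(δ) - 1)` (`IsDistance.edgeMult_eq`), where `M_J` is `meanDist J.exponents`, a strictly
increasing function of `δ`.

Moreover `δ` is an ultrametric distance (`IsDistance.le_max`), and `M_I(δ) = M_J(δ)` since only
exponents above `δ` matter (`meanDist_eq`). If `B_{I,J} = B_{J,K} = 0`, strict monotonicity of `M_J`
forces both distances to be equal, so the distance from `I` to `K` is at most that value and
`B_{I,K} ≤ 0` (`edgeMult_nonpos_of_eq_zero`). In a graph this means `B_{I,K} = 0`. Non-adjacency is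
therefore an equivalence relation, and a simply-laced graph with this property is complete
multipartite.

Conversely, in the untwisted case `B_{I,J} = δ - 1`. The factors `a z ^ 2 + b z`, with `a` encoding
the part and `b` the vertex, have `δ = 2` across parts and `δ = 1` inside a part. A diagonal
connection realises them. -/

noncomputable section

namespace StokesCircle

/-! ### Greatest common divisors as reciprocals of common denominators. -/

/-- The reciprocal of the least common denominator of a finite set of rationals. -/
def invDen (S : Finset ℚ) : ℚ := ((S.lcm Rat.den : ℕ) : ℚ)⁻¹

theorem lcm_den_pos (S : Finset ℚ) : 0 < S.lcm Rat.den := by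
  rw [Nat.pos_iff_ne_zero, Ne, Finset.lcm_eq_zero_iff]
  rintro ⟨k, -, hk⟩
  exact k.den_ne_zero hk

theorem invDen_pos (S : Finset ℚ) : 0 < invDen S := by
  have := lcm_den_pos S
  unfold invDen
  positivity

theorem invDen_anti {S T : Finset ℚ} (h : S ⊆ T) : invDen T ≤ invDen S := by
  have h1 : S.lcm Rat.den ≤ T.lcm Rat.den :=
    Nat.le_of_dvd (lcm_den_pos T) (Finset.lcm_mono h)
  have h2 : (0 : ℚ) < (S.lcm Rat.den : ℕ) := by exact_mod_cast lcm_den_pos S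
  unfold invDen
  gcongr

/-- Both hypotheses matter: `numer` takes the absolute value of a reduced numerator, which is `r *
k` only if `r * k` is a nonnegative integer. -/
theorem cast_numer {r : ℕ} {k : ℚ} (hk : 0 ≤ k) (hd : k.den ∣ r) : (numer r k : ℚ) = r * k := by
  obtain ⟨c, rfl⟩ := hd
  have h : ((k.den * c : ℕ) : ℚ) * k = ((k.num * c : ℤ) : ℚ) := by
    push_cast
    rw [mul_right_comm, Rat.den_mul_eq_num]
  have h0 : 0 ≤ k.num * (c : ℤ) := mul_nonneg (Rat.num_nonneg.mpr hk) (by positivity)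
  rw [numer, h, Rat.num_intCast, ← Int.cast_natCast, Int.natAbs_of_nonneg h0]

/-- Both sides say that `y * k` is an integer. -/
theorem dvd_numer_iff {x y : ℕ} {k : ℚ} (hx : x ≠ 0) (hk : 0 ≤ k) (hd : k.den ∣ x * y) :
    x ∣ numer (x * y) k ↔ k.den ∣ y := by
  have hx' : (x : ℚ) ≠ 0 := by exact_mod_cast hx
  have hc := cast_numer hk hd
  constructor
  · rintro ⟨e, he⟩
    rw [he] at hc
    push_cast at hc
    have h1 : (e : ℚ) = y * k := by
      apply mul_left_cancel₀ hx'
      rw [hc, mul_assoc]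
    have h2 : (e : ℤ) * k.den = y * k.num := by
      have : (e : ℚ) * k.den = y * k.num := by rw [h1, mul_assoc, Rat.mul_den_eq_num]
      exact_mod_cast this
    have h3 : (k.den : ℤ) ∣ y * k.num := ⟨e, by rw [← h2, mul_comm]⟩
    have h4 : IsCoprime (k.den : ℤ) k.num := by
      rw [Int.isCoprime_iff_gcd_eq_one, Int.gcd_comm]
      exact k.reduced
    exact_mod_cast h4.dvd_of_dvd_mul_right h3
  · rintro hy
    refine ⟨numer y k, ?_⟩
    have : (numer (x * y) k : ℚ) = ((x * numer y k : ℕ) : ℚ) := by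
      rw [hc, Nat.cast_mul x (numer y k), cast_numer hk hy]
      push_cast
      ring
    exact_mod_cast this

/-- Divisors of `r` are paired by `x ↔ r / x`, and `x` divides the gcd exactly when `r / x` is a
common denominator of `S`. So the largest such `x` corresponds to the least common denominator. -/
theorem gcdOf_mul_lcm {r : ℕ} (hr : r ≠ 0) {S : Finset ℚ} (hS : ∀ k ∈ S, 0 ≤ k ∧ k.den ∣ r) :
    gcdOf r S * S.lcm Rat.den = r := by
  have hdvd : ∀ x y : ℕ, r = x * y → (x ∣ gcdOf r S ↔ S.lcm Rat.den ∣ y) := by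
    rintro x y rfl
    have hx : x ≠ 0 := left_ne_zero_of_mul hr
    rw [gcdOf, Nat.dvd_gcd_iff, Finset.dvd_gcd_iff, Finset.lcm_dvd_iff]
    refine ⟨fun h k hk => ?_, fun h => ⟨dvd_mul_right x y, fun k hk => ?_⟩⟩
    · exact (dvd_numer_iff hx (hS k hk).1 (hS k hk).2).1 (h.2 k hk)
    · exact (dvd_numer_iff hx (hS k hk).1 (hS k hk).2).2 (h k hk)
  obtain ⟨c, hc⟩ : S.lcm Rat.den ∣ r := Finset.lcm_dvd fun k hk => (hS k hk).2
  obtain ⟨y, hy⟩ : gcdOf r S ∣ r := Nat.gcd_dvd_left _ _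
  have h1 : c ∣ gcdOf r S := (hdvd c _ (by rw [hc, mul_comm])).2 dvd_rfl
  have h2 : S.lcm Rat.den ∣ y := (hdvd _ y hy).1 dvd_rfl
  refine Nat.dvd_antisymm ?_ ?_
  · exact (mul_dvd_mul_left _ h2).trans hy.symm.dvd
  · conv_lhs => rw [hc, mul_comm]
    exact mul_dvd_mul_right h1 _

theorem cast_gcdOf {r : ℕ} (hr : r ≠ 0) {S : Finset ℚ} (hS : ∀ k ∈ S, 0 ≤ k ∧ k.den ∣ r) :
    (gcdOf r S : ℚ) = r * invDen S := by
  have h := gcdOf_mul_lcm hr hS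
  have h2 : ((S.lcm Rat.den : ℕ) : ℚ) ≠ 0 := by exact_mod_cast (lcm_den_pos S).ne'
  rw [invDen, eq_mul_inv_iff_mul_eq₀ h2]
  exact_mod_cast h

/-! ### The mean distance function. -/

/-- The mean over the Galois orbit of an exponential factor `q` with set of exponents `E` of
`max δ (slope (q - q'))`. -/
def meanDist (E : Finset ℚ) (δ : ℚ) : ℚ :=
  ∑ k ∈ E, max k δ * (invDen (E.filter (k < ·)) - invDen (E.filter (k ≤ ·))) + δ * invDen E

/-- Every weight is nonnegative, and the weight `invDen E` of the last term, which is linear in `δ`,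
is positive. -/
theorem meanDist_strictMono (E : Finset ℚ) : StrictMono (meanDist E) := by
  intro a b hab
  refine add_lt_add_of_le_of_lt (Finset.sum_le_sum fun k _ => ?_) ?_
  · have h : invDen (E.filter (k ≤ ·)) ≤ invDen (E.filter (k < ·)) :=
      invDen_anti (Finset.monotone_filter_right _ fun _ _ h => le_of_lt h)
    have := sub_nonneg.mpr h
    gcongr
  · have := invDen_pos E
    gcongr

/-- Exponents `≤ δ` contribute `δ` times a telescoping sum of weights, so they can be dropped. This
makes the value depend only on the part common to two circles at distance `δ`. The induction adds
exponents from the largest down, since a new minimum leaves the other weights unchanged. -/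
theorem meanDist_eq (E : Finset ℚ) (δ : ℚ) :
    meanDist E δ = ∑ k ∈ E.filter (δ < ·), k * (invDen ((E.filter (δ < ·)).filter (k < ·))
      - invDen ((E.filter (δ < ·)).filter (k ≤ ·))) + δ * invDen (E.filter (δ < ·)) := by
  induction E using Finset.induction_on_min with
  | empty => simp [meanDist]
  | insert a E ha ih =>
    have hna : a ∉ E := fun h => lt_irrefl _ (ha a h)
    by_cases hδ : δ < a
    · have hE : (insert a E).filter (δ < ·) = insert a E := by
        rw [Finset.filter_eq_self]
        intro x hx
        rcases Finset.mem_insert.mp hx with rfl | hx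
        · exact hδ
        · exact hδ.trans (ha x hx)
      rw [hE, meanDist]
      congr 1
      refine Finset.sum_congr rfl fun k hk => ?_
      rw [max_eq_left]
      rw [← hE] at hk
      exact (Finset.mem_filter.mp hk).2.le
    · have hE : (insert a E).filter (δ < ·) = E.filter (δ < ·) := by
        rw [Finset.filter_insert, if_neg hδ]
      have h1 : (insert a E).filter (a < ·) = E := by
        rw [Finset.filter_insert, if_neg (lt_irrefl a), Finset.filter_eq_self]
        exact ha
      have h2 : (insert a E).filter (a ≤ ·) = insert a E := by
        rw [Finset.filter_eq_self]
        intro x hx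
        rcases Finset.mem_insert.mp hx with rfl | hx
        · exact le_rfl
        · exact (ha x hx).le
      rw [hE, ← ih, meanDist, meanDist, Finset.sum_insert hna, h1, h2,
        max_eq_right (not_lt.mp hδ)]
      have h3 : ∀ k ∈ E, max k δ * (invDen ((insert a E).filter (k < ·))
          - invDen ((insert a E).filter (k ≤ ·))) =
          max k δ * (invDen (E.filter (k < ·)) - invDen (E.filter (k ≤ ·))) := by
        intro k hk
        rw [Finset.filter_insert, if_neg (ha k hk).not_gt, Finset.filter_insert,
          if_neg (ha k hk).not_ge]
      rw [Finset.sum_congr rfl h3]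
      ring

/-! ### Truncations -/

theorem exponents_trunc (l : ℚ) (I : StokesCircle) :
    (I.trunc l).exponents = I.exponents.filter (l ≤ ·) := by
  induction I using Quotient.inductionOn with
  | h q => exact Finsupp.support_filter _ _

theorem exponents_pos {I : StokesCircle} {k : ℚ} (hk : k ∈ I.exponents) : 0 < k := by
  induction I using Quotient.inductionOn with
  | h q => exact q.pos k hk

theorem ram_eq (I : StokesCircle) : I.ram = I.exponents.lcm Rat.den := by
  induction I using Quotient.inductionOn with
  | h q => rfl

theorem ram_pos (I : StokesCircle) : 0 < I.ram := by
  rw [ram_eq]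
  exact lcm_den_pos _

theorem den_dvd_ram {I : StokesCircle} {k : ℚ} (hk : k ∈ I.exponents) : k.den ∣ I.ram := by
  rw [ram_eq]
  exact Finset.dvd_lcm hk

theorem trunc_trunc (l l' : ℚ) (I : StokesCircle) :
    (I.trunc l).trunc l' = I.trunc (max l l') := by
  induction I using Quotient.inductionOn with
  | h q =>
    refine congrArg (Quotient.mk ExpFactor.setoid) (ExpFactor.ext ?_)
    ext k
    by_cases h1 : l ≤ k <;> by_cases h2 : l' ≤ k <;> simp [ExpFactor.trunc, h1, h2]

theorem trunc_congr {I : StokesCircle} {l l' : ℚ} (h : ∀ k ∈ I.exponents, l ≤ k ↔ l' ≤ k) :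
    I.trunc l = I.trunc l' := by
  induction I using Quotient.inductionOn with
  | h q =>
    refine congrArg (Quotient.mk ExpFactor.setoid) (ExpFactor.ext ?_)
    ext k
    by_cases hk : q.coeff k = 0
    · simp [ExpFactor.trunc, Finsupp.filter_apply, hk]
    · have := h k (Finsupp.mem_support_iff.mpr hk)
      simp [ExpFactor.trunc, Finsupp.filter_apply, this]

theorem trunc_eq_self {I : StokesCircle} {l : ℚ} (h : ∀ k ∈ I.exponents, l ≤ k) :
    I.trunc l = I := by
  induction I using Quotient.inductionOn with
  | h q =>
    refine congrArg (Quotient.mk ExpFactor.setoid) (ExpFactor.ext ?_)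
    ext k
    by_cases hk : q.coeff k = 0
    · simp [ExpFactor.trunc, Finsupp.filter_apply, hk]
    · have := h k (Finsupp.mem_support_iff.mpr hk)
      simp [ExpFactor.trunc, this]

theorem trunc_eq_of_lt {I : StokesCircle} {l : ℚ} (h : ∀ k ∈ I.exponents, k < l) :
    I.trunc l = ExpFactor.circle ⟨0, by simp⟩ := by
  induction I using Quotient.inductionOn with
  | h q =>
    refine congrArg (Quotient.mk ExpFactor.setoid) (ExpFactor.ext ?_)
    ext k
    by_cases hk : q.coeff k = 0
    · simp [ExpFactor.trunc, Finsupp.filter_apply, hk]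
    · have := h k (Finsupp.mem_support_iff.mpr hk)
      simp [ExpFactor.trunc, this]

theorem exists_nat_div_of_den_dvd {L : ℕ} (hL : L ≠ 0) {k : ℚ} (hk : 0 ≤ k) (hd : k.den ∣ L) :
    ∃ n : ℕ, k = (n : ℚ) / L := by
  have hL' : (L : ℚ) ≠ 0 := by exact_mod_cast hL
  exact ⟨numer L k, by rw [cast_numer hk hd]; field_simp⟩

/-! ### The ultrametric distance between Stokes circles. -/

/-- `δ` is the largest exponent at which two Stokes circles differ. -/
def IsDistance (I J : StokesCircle) (δ : ℚ) : Prop :=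
  I.trunc δ ≠ J.trunc δ ∧ ∀ l, δ < l → I.trunc l = J.trunc l

theorem IsDistance.symm {I J : StokesCircle} {δ : ℚ} (h : IsDistance I J δ) :
    IsDistance J I δ :=
  ⟨h.1.symm, fun l hl => (h.2 l hl).symm⟩

theorem IsDistance.le {I J : StokesCircle} {δ l : ℚ} (h : IsDistance I J δ)
    (hl : I.trunc l ≠ J.trunc l) : l ≤ δ :=
  not_lt.mp fun hlt => hl (h.2 l hlt)

theorem IsDistance.unique {I J : StokesCircle} {δ δ' : ℚ} (h : IsDistance I J δ)
    (h' : IsDistance I J δ') : δ = δ' :=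
  le_antisymm (h'.le h.1) (h.le h'.1)

theorem IsDistance.le_max {I J K : StokesCircle} {a b c : ℚ} (hIJ : IsDistance I J a)
    (hJK : IsDistance J K b) (hIK : IsDistance I K c) : c ≤ max a b := by
  refine not_lt.mp fun h => hIK.1 ?_
  rw [hIJ.2 c (lt_of_le_of_lt (le_max_left _ _) h), hJK.2 c (lt_of_le_of_lt (le_max_right _ _) h)]

theorem IsDistance.filter_eq {I J : StokesCircle} {δ : ℚ} (h : IsDistance I J δ) :
    I.exponents.filter (δ < ·) = J.exponents.filter (δ < ·) := by
  ext k
  simp only [Finset.mem_filter]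
  have : ∀ hk : δ < k, (k ∈ I.exponents ↔ k ∈ J.exponents) := fun hk => by
    have h1 := congrArg StokesCircle.exponents (h.2 k hk)
    rw [exponents_trunc, exponents_trunc] at h1
    simpa using Finset.ext_iff.mp h1 k
  tauto

/-- Otherwise no exponent of either circle lies in `[δ, T)`, so cutting at `δ` or at `T` removes the
same monomials, although the circles agree at `T` and differ at `δ`. -/
theorem IsDistance.mem_or_mem {I J : StokesCircle} {δ T : ℚ} (h : IsDistance I J δ) (hT : δ < T)
    (hgap : ∀ k, k ∈ I.exponents ∨ k ∈ J.exponents → (k < T ↔ k ≤ δ)) :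
    δ ∈ I.exponents ∨ δ ∈ J.exponents := by
  by_contra! hne
  have key : ∀ K : StokesCircle, δ ∉ K.exponents → (∀ k ∈ K.exponents, (k < T ↔ k ≤ δ)) →
      K.trunc δ = K.trunc T := by
    intro K hK hg
    refine trunc_congr fun k hk => ⟨fun h1 => ?_, fun h1 => hT.le.trans h1⟩
    by_contra! h2
    exact hK (le_antisymm h1 ((hg k hk).1 h2) ▸ hk)
  apply h.1
  rw [key I hne.1 fun k hk => hgap k (Or.inl hk), key J hne.2 fun k hk => hgap k (Or.inr hk),
    h.2 T hT]

/-- With `L` the lcm of the ramification orders, all exponents lie on the grid `(1 / L) ℤ`. The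
distance is the grid point just below the common threshold, so no exponent lies strictly between the
two. -/
theorem exists_isDistance {I J : StokesCircle} (hIJ : I ≠ J) :
    ∃ δ, 0 < δ ∧ IsDistance I J δ ∧ δ < commonThreshold I J ∧
      ∀ k, k ∈ I.exponents ∨ k ∈ J.exponents → (k < commonThreshold I J ↔ k ≤ δ) := by
  set L := Nat.lcm I.ram J.ram with hL
  have hL0 : L ≠ 0 := Nat.lcm_ne_zero I.ram_pos.ne' J.ram_pos.ne'
  have hLpos : (0 : ℚ) < L := by exact_mod_cast Nat.pos_of_ne_zero hL0
  have hexp : ∀ k, k ∈ I.exponents ∨ k ∈ J.exponents → ∃ n : ℕ, 0 < n ∧ k = (n : ℚ) / L := by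
    intro k hk
    have hk0 : 0 < k := hk.elim exponents_pos exponents_pos
    have hd : k.den ∣ L := hk.elim (fun h => (den_dvd_ram h).trans (Nat.dvd_lcm_left _ _))
      fun h => (den_dvd_ram h).trans (Nat.dvd_lcm_right _ _)
    obtain ⟨n, rfl⟩ := exists_nat_div_of_den_dvd hL0 hk0.le hd
    refine ⟨n, Nat.pos_of_ne_zero ?_, rfl⟩
    rintro rfl
    simp at hk0
  set S : Set ℕ := {n : ℕ | 0 < n ∧ I.trunc ((n : ℚ) / L) = J.trunc ((n : ℚ) / L)} with hS
  have hT : commonThreshold I J = (sInf S : ℕ) / L := rfl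
  -- Beyond all exponents both truncations are `⟨0⟩`. Nonemptiness rules out the default value `sInf
  -- ∅ = 0`.
  have hne : S.Nonempty := by
    obtain ⟨M, hM⟩ := (I.exponents ∪ J.exponents).bddAbove
    obtain ⟨n, hn⟩ := exists_nat_gt (max (M * L) 0)
    have hn0 : (0 : ℚ) < n := lt_of_le_of_lt (le_max_right _ _) hn
    have hlt : ∀ k ∈ I.exponents ∪ J.exponents, k < (n : ℚ) / L := fun k hk =>
      lt_of_le_of_lt (hM hk) ((lt_div_iff₀ hLpos).mpr (lt_of_le_of_lt (le_max_left _ _) hn))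
    refine ⟨n, by exact_mod_cast hn0, ?_⟩
    rw [trunc_eq_of_lt fun k hk => hlt k (Finset.mem_union_left _ hk),
      trunc_eq_of_lt fun k hk => hlt k (Finset.mem_union_right _ hk)]
  obtain ⟨hpos, heq⟩ := Nat.sInf_mem hne
  obtain ⟨m, hm⟩ : ∃ m, sInf S = m + 1 := ⟨sInf S - 1, by omega⟩
  rw [hm] at hT heq
  have hle : ∀ {a b : ℕ}, (a : ℚ) / L ≤ (b : ℚ) / L ↔ a ≤ b := by
    intro a b
    rw [div_le_div_iff_of_pos_right hLpos, Nat.cast_le]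
  -- A threshold of `1 / L` would truncate nothing and give `I = J`.
  have hm0 : 0 < m := by
    rw [Nat.pos_iff_ne_zero]
    rintro rfl
    apply hIJ
    rwa [trunc_eq_self, trunc_eq_self] at heq
    · intro k hk
      obtain ⟨n, hn, rfl⟩ := hexp k (Or.inr hk)
      exact hle.2 hn
    · intro k hk
      obtain ⟨n, hn, rfl⟩ := hexp k (Or.inl hk)
      exact hle.2 hn
  have hgap : ∀ k, k ∈ I.exponents ∨ k ∈ J.exponents →
      (k < commonThreshold I J ↔ k ≤ (m : ℚ) / L) := by
    intro k hk
    obtain ⟨n, hn, rfl⟩ := hexp k hk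
    rw [hT, hle, ← not_le, hle]
    omega
  have hlt : (m : ℚ) / L < commonThreshold I J := by
    rw [hT, ← not_le, hle]
    omega
  refine ⟨(m : ℚ) / L, by positivity, ⟨fun h => ?_, fun l hl => ?_⟩, hlt, hgap⟩
  · exact Nat.notMem_of_lt_sInf (s := S) (m := m) (by omega) ⟨hm0, h⟩
  · have key : ∀ K : StokesCircle,
        (∀ k ∈ K.exponents, (k < commonThreshold I J ↔ k ≤ (m : ℚ) / L)) →
        K.trunc l = (K.trunc (commonThreshold I J)).trunc l := by
      intro K hK
      rw [trunc_trunc]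
      refine trunc_congr fun k hk => ⟨fun h => max_le ?_ h, fun h => (le_max_right _ _).trans h⟩
      rw [← not_lt, hK k hk]
      exact not_le.mpr (hl.trans_le h)
    rw [key I fun k hk => hgap k (Or.inl hk), key J fun k hk => hgap k (Or.inr hk), hT, heq]

/-! ### Edge multiplicities in terms of the distance. -/

theorem diffSlope_le {I J : StokesCircle} {δ : ℚ} (h0 : 0 ≤ δ)
    (h : ∀ k ∈ I.exponents, k < commonThreshold I J → k ≤ δ) : diffSlope I J ≤ δ := by
  refine Finset.max'_le _ _ _ fun k hk => ?_
  rcases Finset.mem_insert.mp hk with rfl | hk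
  · exact h0
  · exact h k (Finset.mem_filter.mp hk).1 (Finset.mem_filter.mp hk).2

theorem le_diffSlope {I J : StokesCircle} {k : ℚ} (hk : k ∈ I.exponents)
    (h : k < commonThreshold I J) : k ≤ diffSlope I J :=
  Finset.le_max' _ _ (Finset.mem_insert_of_mem (Finset.mem_filter.mpr ⟨hk, h⟩))

theorem commonThreshold_comm (I J : StokesCircle) :
    commonThreshold I J = commonThreshold J I := by
  simp only [commonThreshold, Nat.lcm_comm I.ram J.ram, eq_comm]

/-- The common part consists of the exponents above `δ`, shared by both circles, so every numerator
over `r` is `r * k` and every gcd is `r' * invDen`. The membership of `δ` in `I.exponents` is what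
makes `s_d = r * δ`. -/
theorem edgeFormula_eq {I J : StokesCircle} {δ : ℚ} (h : IsDistance I J δ)
    (hgap : ∀ k, k ∈ I.exponents ∨ k ∈ J.exponents → (k < commonThreshold I J ↔ k ≤ δ))
    (hδ : diffSlope I J = δ) (hI : δ ∈ I.exponents) :
    (edgeFormula I J : ℚ) = I.ram * J.ram * (meanDist J.exponents δ - 1) := by
  have hcI : (commonPart I J).exponents = I.exponents.filter (δ < ·) := by
    rw [commonPart, exponents_trunc]
    refine Finset.filter_congr fun k hk => ?_
    rw [← not_lt, hgap k (Or.inl hk), not_le]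
  have hcJ : (commonPart I J).exponents = J.exponents.filter (δ < ·) := hcI.trans h.filter_eq
  have hg : ∀ S ⊆ (commonPart I J).exponents, (gcdOf J.ram S : ℚ) = J.ram * invDen S := by
    intro S hS
    refine cast_gcdOf J.ram_pos.ne' fun k hk => ?_
    have := hS hk
    rw [hcJ] at this
    exact ⟨(exponents_pos (Finset.mem_filter.mp this).1).le,
      den_dvd_ram (Finset.mem_filter.mp this).1⟩
  have hn : ∀ k ∈ I.exponents, (numer I.ram k : ℚ) = I.ram * k := fun k hk =>
    cast_numer (exponents_pos hk).le (den_dvd_ram hk)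
  rw [edgeFormula, hδ, meanDist_eq, ← hcJ]
  push_cast
  rw [hg _ subset_rfl, hn δ hI]
  have hsum : ∀ k ∈ (commonPart I J).exponents, (numer I.ram k : ℚ) *
      ((gcdOf J.ram ((commonPart I J).exponents.filter (fun l => k < l)) : ℚ)
        - (gcdOf J.ram ((commonPart I J).exponents.filter (fun l => k ≤ l)) : ℚ)) =
      I.ram * J.ram * (k * (invDen ((commonPart I J).exponents.filter (k < ·))
        - invDen ((commonPart I J).exponents.filter (k ≤ ·)))) := by
    intro k hk
    rw [hg _ (Finset.filter_subset _ _), hg _ (Finset.filter_subset _ _), hn k]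
    · ring
    · rw [hcI] at hk
      exact (Finset.mem_filter.mp hk).1
  rw [Finset.sum_congr rfl hsum, ← Finset.mul_sum]
  ring

theorem IsDistance.meanDist_eq {I J : StokesCircle} {δ : ℚ} (h : IsDistance I J δ) :
    meanDist I.exponents δ = meanDist J.exponents δ := by
  rw [StokesCircle.meanDist_eq, StokesCircle.meanDist_eq, h.filter_eq]

/-- The edge multiplicity is governed by the mean distance between the Galois orbits. -/
theorem IsDistance.edgeMult_eq {I J : StokesCircle} {δ : ℚ} (h : IsDistance I J δ) (hIJ : I ≠ J) :
    (edgeMult I J : ℚ) = I.ram * J.ram * (meanDist J.exponents δ - 1) := by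
  obtain ⟨δ', hpos, hd, hT, hgap⟩ := exists_isDistance hIJ
  obtain rfl := hd.unique h
  have hgap' : ∀ k, k ∈ J.exponents ∨ k ∈ I.exponents →
      (k < commonThreshold J I ↔ k ≤ δ') := fun k hk => by
    rw [commonThreshold_comm]
    exact hgap k hk.symm
  have hT' : δ' < commonThreshold J I := commonThreshold_comm I J ▸ hT
  have hle : diffSlope I J ≤ δ' := diffSlope_le hpos.le fun k hk => (hgap k (Or.inl hk)).1
  have hle' : diffSlope J I ≤ δ' := diffSlope_le hpos.le fun k hk => (hgap' k (Or.inl hk)).1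
  -- As `δ' > 0`, the maximum is not the inserted default `0`.
  have hmem : ∀ {K K' : StokesCircle}, diffSlope K K' = δ' → δ' ∈ K.exponents := by
    intro K K' hK
    have := Finset.max'_mem (insert 0 (K.exponents.filter (fun k => k < commonThreshold K K')))
      (Finset.insert_nonempty _ _)
    rw [← diffSlope, hK] at this
    rcases Finset.mem_insert.mp this with h0 | h0
    · exact absurd h0 hpos.ne'
    · exact (Finset.mem_filter.mp h0).1
  -- At least one of the two different parts has slope `δ'`, and the case split in `edgeMult`
  -- selects such a one.
  have hor := hd.mem_or_mem hT hgap
  rw [edgeMult]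
  split_ifs with hs
  · have hδ : diffSlope I J = δ' := by
      refine le_antisymm hle ?_
      rcases hor with h1 | h1
      · exact le_diffSlope h1 hT
      · exact (le_diffSlope h1 hT').trans hs
    exact edgeFormula_eq h hgap hδ (hmem hδ)
  · have hδ : diffSlope J I = δ' := by
      refine le_antisymm hle' ?_
      rcases hor with h1 | h1
      · exact (le_diffSlope h1 hT).trans (not_le.mp hs).le
      · exact le_diffSlope h1 hT'
    rw [edgeFormula_eq h.symm hgap' hδ (hmem hδ), h.meanDist_eq]
    ring

theorem IsDistance.edgeMult_eq_zero_iff {I J : StokesCircle} {δ : ℚ} (h : IsDistance I J δ)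
    (hIJ : I ≠ J) : edgeMult I J = 0 ↔ meanDist J.exponents δ = 1 := by
  have hI := I.ram_pos.ne'
  have hJ := J.ram_pos.ne'
  rw [← Int.cast_eq_zero (α := ℚ), h.edgeMult_eq hIJ]
  simp [hI, hJ, sub_eq_zero]

/-- Only an inequality holds, because `I` and `K` may be closer to each other than to `J`.
Nonnegativity of edges in a graph supplies the converse bound. -/
theorem edgeMult_nonpos_of_eq_zero {I J K : StokesCircle} (hIJ : I ≠ J) (hJK : J ≠ K)
    (hIK : I ≠ K) (h1 : edgeMult I J = 0) (h2 : edgeMult J K = 0) : edgeMult I K ≤ 0 := by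
  obtain ⟨a, -, ha, -⟩ := exists_isDistance hIJ
  obtain ⟨b, -, hb, -⟩ := exists_isDistance hJK
  obtain ⟨c, -, hc, -⟩ := exists_isDistance hIK
  rw [ha.edgeMult_eq_zero_iff hIJ] at h1
  rw [hb.edgeMult_eq_zero_iff hJK] at h2
  obtain rfl : a = b := (meanDist_strictMono J.exponents).injective
    (h1.trans (h2.symm.trans hb.meanDist_eq.symm))
  have hca : c ≤ a := (ha.le_max hb hc).trans_eq (max_self a)
  have hle : meanDist K.exponents c ≤ 1 := ((meanDist_strictMono _).monotone hca).trans_eq h2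
  rw [← Int.cast_nonpos (R := ℚ), hc.edgeMult_eq hIK]
  exact mul_nonpos_of_nonneg_of_nonpos (by positivity) (sub_nonpos.mpr hle)

/-! ### Untwisted circles. -/

theorem invDen_eq_one {S : Finset ℚ} (h : S.lcm Rat.den = 1) : invDen S = 1 := by
  simp [invDen, h]

/-- The Galois orbit is a single point, so all weights vanish except the last, which is `1`. -/
theorem meanDist_of_untwisted {E : Finset ℚ} (hE : E.lcm Rat.den = 1) (δ : ℚ) :
    meanDist E δ = δ := by
  have h : ∀ S ⊆ E, invDen S = 1 := fun S hS =>
    invDen_eq_one (Nat.dvd_one.mp (hE ▸ Finset.lcm_mono hS))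
  rw [meanDist, h E subset_rfl, Finset.sum_eq_zero, zero_add, mul_one]
  intro k _
  rw [h _ (Finset.filter_subset _ _), h _ (Finset.filter_subset _ _), sub_self, mul_zero]

theorem IsDistance.edgeMult_of_untwisted {I J : StokesCircle} {δ : ℚ} (h : IsDistance I J δ)
    (hIJ : I ≠ J) (hI : I.ram = 1) (hJ : J.ram = 1) : (edgeMult I J : ℚ) = δ - 1 := by
  rw [h.edgeMult_eq hIJ, meanDist_of_untwisted (J.ram_eq ▸ hJ), hI, hJ]
  simp

theorem loopMult_of_untwisted {I : StokesCircle} (hI : I.ram = 1) : loopMult I = 0 := by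
  simp [loopMult, hI, gcdOf]

end StokesCircle

/-! ### Non-adjacency and complete multipartite graphs. -/

namespace Diagram

variable {N : Type*}

/-- A diagram with edge multiplicities `0` and `1` in which non-adjacency is transitive is a
complete multipartite graph. -/
theorem IsSimplyLaced.exists_isCompletePartite [Finite N] [Nonempty N] {Γ : Diagram N}
    (h : Γ.IsSimplyLaced)
    (htrans : ∀ i j k, Γ.B i j = 0 → Γ.B j k = 0 → Γ.B i k = 0) :
    ∃ k : ℕ, 1 ≤ k ∧ Γ.IsCompletePartite k := by
  -- Reflexivity is the absence of loops. The parts are the classes of this relation.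
  let s : Setoid N :=
    { r := fun i j => Γ.B i j = 0
      iseqv := ⟨h.1.2, fun {i j} hij => (Γ.symm j i).trans hij, fun {i j k} => htrans i j k⟩ }
  obtain ⟨k, ⟨e⟩⟩ := Finite.exists_equiv_fin (Quotient s)
  have hiff : ∀ i j, e (Quotient.mk s i) = e (Quotient.mk s j) ↔ Γ.B i j = 0 := fun i j => by
    rw [e.injective.eq_iff, Quotient.eq]
    rfl
  refine ⟨k, ?_, fun i => e (Quotient.mk s i), e.surjective.comp Quotient.mk_surjective,
    fun i j hij => (hiff i j).1 hij, fun i j hij => ?_⟩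
  · obtain ⟨i⟩ := ‹Nonempty N›
    exact Fin.pos (e (Quotient.mk s i))
  · rw [Ne, hiff] at hij
    exact (h.2 i j (fun hEq => hij (hEq ▸ h.1.2 i))).resolve_left hij

theorem IsCompletePartite.isSimplyLaced {Γ : Diagram N} {k : ℕ} (h : Γ.IsCompletePartite k) :
    Γ.IsSimplyLaced := by
  obtain ⟨f, -, h0, h1⟩ := h
  have h01 : ∀ i j, Γ.B i j = 0 ∨ Γ.B i j = 1 := fun i j =>
    (em (f i = f j)).imp (h0 i j) (h1 i j)
  refine ⟨⟨fun i j => ?_, fun i => h0 i i rfl⟩, fun i j _ => h01 i j⟩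
  rcases h01 i j with h | h <;> simp [h]

theorem IsCoreDiagramOf.exists_isCompletePartite [Finite N] [Nonempty N] {Γ : Diagram N}
    {Θ : IrregularClass} (hΘ : Γ.IsCoreDiagramOf Θ) (h : Γ.IsSimplyLaced) :
    ∃ k : ℕ, 1 ≤ k ∧ Γ.IsCompletePartite k := by
  obtain ⟨e, -, he⟩ := hΘ
  refine h.exists_isCompletePartite fun i j k hij hjk => ?_
  by_cases h1 : i = j
  · rwa [h1]
  by_cases h2 : j = k
  · rwa [← h2]
  by_cases h3 : i = k
  · rw [h3]
    exact h.1.2 k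
  have hne : ∀ {a b}, a ≠ b → (e a).1 ≠ (e b).1 := fun hab hEq =>
    hab (e.injective (Subtype.ext hEq))
  rw [he i j h1] at hij
  rw [he j k h2] at hjk
  refine le_antisymm ?_ (h.1.1 i k)
  rw [he i k h3]
  exact StokesCircle.edgeMult_nonpos_of_eq_zero (hne h1) (hne h2) (hne h3) hij hjk

end Diagram

/-! ### Quadratic exponential factors. -/

namespace ExpFactor

/-- The exponential factor `a z ^ 2 + b z`. -/
def quadratic (a b : ℂ) : ExpFactor where
  coeff := Finsupp.single 2 a + Finsupp.single 1 b
  pos k hk := by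
    classical
    rcases Finset.mem_union.mp (Finsupp.support_add hk) with h | h <;>
      rw [Finset.mem_singleton.mp (Finsupp.support_single_subset h)] <;> norm_num

variable {a b a' b' : ℂ}

theorem quadratic_coeff_two : (quadratic a b).coeff 2 = a := by
  simp [quadratic]

theorem quadratic_coeff_one : (quadratic a b).coeff 1 = b := by
  simp [quadratic]

/-- Only an inclusion, since `a` or `b` may vanish. The realisation below does use the value `0` for
both. -/
theorem quadratic_exponents_subset : (quadratic a b).exponents ⊆ {2, 1} := by
  classical
  intro k hk
  rcases Finset.mem_union.mp (Finsupp.support_add hk) with h | h <;>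
    simp [Finset.mem_singleton.mp (Finsupp.support_single_subset h)]

theorem quadratic_ram : (quadratic a b).ram = 1 :=
  Nat.dvd_one.mp ((Finset.lcm_mono quadratic_exponents_subset).trans (by simp))

theorem quadratic_toLaurent :
    (quadratic a b).toLaurent 1 = HahnSeries.single (-2) a + HahnSeries.single (-1) b := by
  have h : (quadratic a b).toLaurent 1 = ∑ k ∈ ({2, 1} : Finset ℚ),
      HahnSeries.single (-(((1 : ℕ) : ℚ) * k).num) ((quadratic a b).coeff k) := by
    refine Finset.sum_subset quadratic_exponents_subset fun k _ hk => ?_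
    rw [Finsupp.notMem_support_iff.mp hk, HahnSeries.single_eq_zero]
  rw [h, Finset.sum_pair (by norm_num), quadratic_coeff_two, quadratic_coeff_one]
  simp

theorem exponents_int_of_ram_eq_one {q : ExpFactor} (hq : q.ram = 1) {k : ℚ}
    (hk : k ∈ q.exponents) : (k.num : ℚ) = k := by
  have h : k.den ∣ q.ram := Finset.dvd_lcm hk
  rw [hq, Nat.dvd_one] at h
  exact Rat.coe_int_num_of_den_eq_one h

/-- Galois conjugation is trivial on untwisted exponential factors. -/
theorem eq_of_equiv_of_ram_eq_one {q q' : ExpFactor} (hq : q.ram = 1) (h : q ≈ q') : q = q' := by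
  obtain ⟨m, h⟩ := h
  ext k
  rw [h k]
  by_cases hk : q.coeff k = 0
  · simp [hk]
  · have h1 := exponents_int_of_ram_eq_one hq (Finsupp.mem_support_iff.mpr hk)
    have h2 : Complex.exp (2 * Real.pi * Complex.I * m * k) = 1 := by
      rw [Complex.exp_eq_one_iff]
      refine ⟨m * k.num, ?_⟩
      conv_lhs => rw [← h1]
      push_cast
      ring
    rw [h2, one_mul]

theorem circle_eq_iff {q q' : ExpFactor} (hq : q.ram = 1) : q.circle = q'.circle ↔ q = q' :=
  ⟨fun h => eq_of_equiv_of_ram_eq_one hq (Quotient.exact h), fun h => h ▸ rfl⟩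

theorem ram_trunc_eq_one {q : ExpFactor} (hq : q.ram = 1) (l : ℚ) : (q.trunc l).ram = 1 := by
  refine Nat.dvd_one.mp (dvd_trans (Finset.lcm_mono ?_) hq.dvd)
  rw [exponents, trunc, Finsupp.support_filter]
  exact Finset.filter_subset _ _

theorem trunc_circle (q : ExpFactor) (l : ℚ) : q.circle.trunc l = (q.trunc l).circle := rfl

theorem trunc_coeff_apply (q : ExpFactor) (l k : ℚ) :
    (q.trunc l).coeff k = if l ≤ k then q.coeff k else 0 :=
  Finsupp.filter_apply _ _ _

/-- Untwisted orbits are singletons, so circles can be compared coefficient by coefficient. -/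
theorem isDistance_iff {q q' : ExpFactor} (hq : q.ram = 1) {δ : ℚ} :
    StokesCircle.IsDistance q.circle q'.circle δ ↔
      q.coeff δ ≠ q'.coeff δ ∧ ∀ l, δ < l → q.coeff l = q'.coeff l := by
  have key : ∀ l, q.circle.trunc l = q'.circle.trunc l ↔ ∀ k, l ≤ k → q.coeff k = q'.coeff k := by
    intro l
    rw [trunc_circle, trunc_circle, circle_eq_iff (ram_trunc_eq_one hq l), ExpFactor.ext_iff,
      DFunLike.ext_iff]
    refine forall_congr' fun k => ?_
    rw [trunc_coeff_apply, trunc_coeff_apply]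
    split_ifs with h <;> simp [h]
  simp only [StokesCircle.IsDistance, Ne, key]
  constructor
  · rintro ⟨h1, h2⟩
    refine ⟨fun h => h1 fun k hk => ?_, fun l hl => h2 l hl l le_rfl⟩
    rcases hk.eq_or_lt with rfl | hk
    · exact h
    · exact h2 k hk k le_rfl
  · rintro ⟨h1, h2⟩
    exact ⟨fun h => h1 (h δ le_rfl), fun l hl k hk => h2 k (hl.trans_le hk)⟩

theorem quadratic_coeff_of_ne {k : ℚ} (h2 : 2 ≠ k) (h1 : 1 ≠ k) : (quadratic a b).coeff k = 0 := by
  simp [quadratic, h1, h2]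

theorem quadratic_circle_eq_iff :
    (quadratic a b).circle = (quadratic a' b').circle ↔ a = a' ∧ b = b' := by
  rw [circle_eq_iff quadratic_ram]
  refine ⟨fun h => ⟨?_, ?_⟩, fun h => by rw [h.1, h.2]⟩
  · rw [← quadratic_coeff_two (a := a) (b := b), h, quadratic_coeff_two]
  · rw [← quadratic_coeff_one (a := a) (b := b), h, quadratic_coeff_one]

theorem edgeMult_quadratic_of_ne (h : a ≠ a') :
    StokesCircle.edgeMult (quadratic a b).circle (quadratic a' b').circle = 1 := by
  have hd : StokesCircle.IsDistance (quadratic a b).circle (quadratic a' b').circle 2 := by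
    rw [isDistance_iff quadratic_ram]
    refine ⟨by rwa [quadratic_coeff_two, quadratic_coeff_two], fun l hl => ?_⟩
    rw [quadratic_coeff_of_ne hl.ne (by linarith), quadratic_coeff_of_ne hl.ne (by linarith)]
  have h1 := hd.edgeMult_of_untwisted (fun hE => h (quadratic_circle_eq_iff.1 hE).1)
    quadratic_ram quadratic_ram
  norm_num at h1
  exact_mod_cast h1

theorem edgeMult_quadratic_of_eq (h : b ≠ b') :
    StokesCircle.edgeMult (quadratic a b).circle (quadratic a b').circle = 0 := by
  have hd : StokesCircle.IsDistance (quadratic a b).circle (quadratic a b').circle 1 := by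
    rw [isDistance_iff quadratic_ram]
    refine ⟨by rwa [quadratic_coeff_one, quadratic_coeff_one], fun l hl => ?_⟩
    by_cases h2 : 2 = l
    · rw [← h2, quadratic_coeff_two, quadratic_coeff_two]
    · rw [quadratic_coeff_of_ne h2 hl.ne, quadratic_coeff_of_ne h2 hl.ne]
  have h1 := hd.edgeMult_of_untwisted (fun hE => h (quadratic_circle_eq_iff.1 hE).2)
    quadratic_ram quadratic_ram
  norm_num at h1
  exact h1

end ExpFactor

/-! ### Diagonal connections -/

namespace AlgConnection

/-- The diagonal connection `d/dz + diag(A_1, …, A_n)`. -/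
def diagonal {n : ℕ} (A : Fin n → ℂ[X]) : AlgConnection where
  E := Fin n → ℂ[X]
  nabla :=
    { toFun := fun s i => Polynomial.derivative (s i) + A i * s i
      map_zero' := by ext1; simp
      map_add' := fun s t => by ext1; simp; ring }
  leibniz f s := by
    ext1
    simp
    ring

theorem connMatrix_diagonal {n : ℕ} (A : Fin n → ℂ[X]) :
    (diagonal A).connMatrix (Pi.basisFun ℂ[X] (Fin n)) = Matrix.diagonal A := by
  ext1 i j
  change Polynomial.derivative ((Pi.basisFun ℂ[X] (Fin n)) j i)
    + A i * (Pi.basisFun ℂ[X] (Fin n)) j i = _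
  by_cases h : i = j
  · subst h
    simp
  · simp [h]

end AlgConnection

theorem eulerD_single (m : ℤ) (c : ℂ) :
    eulerD (HahnSeries.single m c) = HahnSeries.single m (m * c) := by
  rw [eulerD]
  simp [LaurentSeries.derivative]

theorem eulerD_add (f g : ℂ⸨X⸩) : eulerD (f + g) = eulerD f + eulerD g := by
  simp [eulerD, mul_add]

/-- The fundamental solution is `exp (diag q)` itself, so `P = 1`, `Λ = 0`, `R = 1`; the equation
`Y' = -A Y` forces `A = -q'`, that is `-(2 a z + b)`. -/
theorem isFormalSolution_diagonal {n : ℕ} (a b : Fin n → ℂ) :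
    IsFormalSolution (Matrix.diagonal fun i => -(Polynomial.C (2 * a i) * Polynomial.X
      + Polynomial.C (b i))) 1 1 0 (fun i => ExpFactor.quadratic (a i) (b i)) where
  pos := one_pos
  ram_dvd i := ExpFactor.quadratic_ram.dvd
  isUnit := isUnit_one
  commute _ _ _ := rfl
  eqn := by
    have h0 : eulerD 0 = 0 := by simp [eulerD]
    have h1 : eulerD 1 = 0 := by simpa using eulerD_single 0 1
    have hP : (1 : Matrix (Fin n) (Fin n) ℂ⸨X⸩).map eulerD = 0 := by
      ext1 i j
      rw [Matrix.map_apply, Matrix.one_apply]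
      split_ifs <;> simp [h0, h1]
    rw [hP, Matrix.map_zero _ (map_zero _), zero_add, zero_add, one_mul, mul_one,
      Matrix.diagonal_map (map_zero _)]
    ext1 i j
    rw [Matrix.smul_apply, smul_eq_mul]
    by_cases h : i = j
    · subst h
      rw [Matrix.diagonal_apply_eq, Matrix.diagonal_apply_eq, ExpFactor.quadratic_toLaurent,
        eulerD_add, eulerD_single, eulerD_single]
      have hC : ∀ c : ℂ, algebraMap ℂ ℂ⸨X⸩ c = HahnSeries.single 0 c := fun c =>
        (HahnSeries.algebraMap_apply' (Γ := ℤ) c).trans (HahnSeries.ofPowerSeries_C c)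
      have hneg : ∀ x y : ℂ⸨X⸩, x * -y = -(x * y) := fun x y => mul_neg x y
      simp [hC, hneg, mul_add, HahnSeries.single_mul_single, add_comm, mul_comm]
    · rw [Matrix.diagonal_apply_ne _ h, Matrix.diagonal_apply_ne _ h]
      exact (mul_zero _).symm

/-- The untwisted irregular class `∑ ⟨a_i z ^ 2 + b_i z⟩`. -/
def quadraticClass {n : ℕ} (a b : Fin n → ℂ) : IrregularClass :=
  ∑ i, Finsupp.single (ExpFactor.quadratic (a i) (b i)).circle 1

section

variable {n : ℕ} (a b : Fin n → ℂ)

theorem quadraticClass_apply (I : StokesCircle) :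
    quadraticClass a b I =
      Nat.card {i : Fin n // (ExpFactor.quadratic (a i) (b i)).circle = I} := by
  classical
  rw [quadraticClass, Finsupp.finsetSum_apply, Nat.card_eq_fintype_card, Fintype.card_subtype,
    Finset.card_filter]
  exact Finset.sum_congr rfl fun i _ => Finsupp.single_apply

theorem mem_support_quadraticClass {I : StokesCircle} :
    I ∈ (quadraticClass a b).support ↔ ∃ i, (ExpFactor.quadratic (a i) (b i)).circle = I := by
  rw [Finsupp.mem_support_iff, quadraticClass_apply, Nat.card_ne_zero,
    nonempty_subtype]
  exact and_iff_left Subtype.finite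

theorem quadraticClass_isUntwisted : (quadraticClass a b).IsUntwisted := by
  intro I hI
  obtain ⟨i, rfl⟩ := (mem_support_quadraticClass a b).1 hI
  exact ExpFactor.quadratic_ram

theorem exists_hasIrregularClass_quadraticClass :
    ∃ V : AlgConnection, V.HasIrregularClass (quadraticClass a b) := by
  refine ⟨AlgConnection.diagonal fun i => -(Polynomial.C (2 * a i) * Polynomial.X
      + Polynomial.C (b i)), n, Pi.basisFun ℂ[X] (Fin n), 1, 1, 0,
      fun i => ExpFactor.quadratic (a i) (b i), ?_, fun p => ?_⟩
  · rw [AlgConnection.connMatrix_diagonal]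
    exact isFormalSolution_diagonal a b
  -- Since conjugation is trivial here, counting equal factors is counting equal circles.
  · simp_rw [quadraticClass_apply, ExpFactor.circle_eq_iff ExpFactor.quadratic_ram]

end

/-! ### Realising complete multipartite graphs. -/

namespace Diagram

variable {N : Type*}

theorem IsCompletePartite.isFissionGraph [Finite N] {Γ : Diagram N} {k : ℕ}
    (h : Γ.IsCompletePartite k) : Γ.IsFissionGraph := by
  obtain ⟨f, -, h0, h1⟩ := h
  obtain ⟨n, ⟨σ⟩⟩ := Finite.exists_equiv_fin N
  -- The leading coefficient labels the part. The linear one labels the vertex and keeps the circles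
  -- distinct.
  let a : Fin n → ℂ := fun i => ((f (σ.symm i) : ℕ) : ℂ)
  let b : Fin n → ℂ := fun i => ((i : ℕ) : ℂ)
  have hb : Function.Injective b := fun i j hij => Fin.ext (Nat.cast_injective hij)
  have ha : ∀ i j, a (σ i) = a (σ j) ↔ f i = f j := fun i j => by
    simp [a, Fin.val_inj]
  obtain ⟨V, hV⟩ := exists_hasIrregularClass_quadraticClass a b
  have hram := quadraticClass_isUntwisted a b
  let g : N → {I : StokesCircle // I ∈ (quadraticClass a b).support} := fun i =>
    ⟨(ExpFactor.quadratic (a (σ i)) (b (σ i))).circle,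
      (mem_support_quadraticClass a b).2 ⟨σ i, rfl⟩⟩
  have hg : Function.Bijective g := by
    constructor
    · intro i j hij
      exact σ.injective (hb (ExpFactor.quadratic_circle_eq_iff.1 (congrArg Subtype.val hij)).2)
    · rintro ⟨I, hI⟩
      obtain ⟨i, rfl⟩ := (mem_support_quadraticClass a b).1 hI
      exact ⟨σ.symm i, Subtype.ext (by simp [g])⟩
  refine ⟨V, quadraticClass a b, hV, hram, Equiv.ofBijective g hg, fun i => ?_, fun i j hij => ?_⟩
  · rw [h0 i i rfl]
    exact (StokesCircle.loopMult_of_untwisted (hram _ (g i).2)).symm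
  · change Γ.B i j = StokesCircle.edgeMult (ExpFactor.quadratic (a (σ i)) (b (σ i))).circle
      (ExpFactor.quadratic (a (σ j)) (b (σ j))).circle
    by_cases hf : f i = f j
    · rw [h0 i j hf, (ha i j).2 hf,
        ExpFactor.edgeMult_quadratic_of_eq fun h => hij (σ.injective (hb h))]
    · rw [h1 i j hf, ExpFactor.edgeMult_quadratic_of_ne fun h => hf ((ha i j).1 h)]

end Diagram

end

theorem proposition4p5 {N : Type*} [Finite N] [Nonempty N] (Γ : Diagram N) :
    (Γ.IsNonabelianHodge → Γ.IsSimplyLaced →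
      Γ.IsFissionGraph ∧ ∃ k : ℕ, 1 ≤ k ∧ Γ.IsCompletePartite k) ∧
    ((Γ.IsFissionGraph ∧ Γ.IsSimplyLaced) ↔ ∃ k : ℕ, 1 ≤ k ∧ Γ.IsCompletePartite k) := by
  refine ⟨?_, ?_, ?_⟩
  · rintro ⟨V, Θ, -, hΘ⟩ h
    obtain ⟨k, hk, hΓ⟩ := hΘ.exists_isCompletePartite h
    exact ⟨hΓ.isFissionGraph, k, hk, hΓ⟩
  · rintro ⟨⟨V, Θ, -, -, hΘ⟩, h⟩
    exact hΘ.exists_isCompletePartite h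
  · rintro ⟨k, -, hΓ⟩
    exact ⟨hΓ.isFissionGraph, hΓ.isSimplyLaced⟩
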